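/- Conventions. For $n\ge 1$ let $U_n=\{z\in\mathbb{C}: z^n=1\}$. For $\alpha=\sum_i a_iT^i\in\mathbb{C}[[T]]$ let $\mathrm{supp}(\alpha)=\{i: a_i\neq 0\}$. A pair $(T^n,\alpha(T))$ with $n\geq 1$ and $\alpha(0)=0$ is a Puiseux parametrisation if $\gcd(\{n\}\cup\mathrm{supp}(\alpha))=1$. Its characteristic is the sequence $(b_0,\dots,b_m)$ with $b_0=n$, $b_{k+1}=\min(\mathrm{supp}(\alpha)\setminus e_k\mathbb{N})$ for $0\le k<m$, and $e_m=1$, where $e_k=\gcd(b_0,\dots,b_k)$. A Weierstrass polynomial of degree $n$ is a monic polynomial $w\in\mathbb{C}[[X]][Y]$ of degree $n$ whose other coefficients have no constant term. If $w$ is irreducible in $\mathbb{C}[[X,Y]]$, its characteristic is that of any Puiseux parametrisation $(T^n,\alpha(T))$ with $w(T^n,\alpha(T))=0$. Let $\widehat{\mathcal F}(b_0,\dots,b_m)$ be the set of irreducible $f=\sum c_{ij}X^iY^j\in\mathbb{C}[[X,Y]]$ of the form $f=u_fw_f$ with $u_f$ a unit and $w_f$ an irreducible Weierstrass polynomial of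 degree $b_0$ and characteristic $(b_0,\dots,b_m)$. A Puiseux parametrisation of $f=0$ is a Puiseux parametrisation $(T^n,\alpha(T))$, $n=b_0$, with $w_f(T^n,\alpha(T))=0$. Note that $c_{0n}\neq 0$ for such $f$. Put $n=b_0$ and $I=e_0\mathbb{N}_+\cup\bigcup_{k=1}^m\bigl(e_k\mathbb{N}\cap[b_k,\infty)\bigr)$. A polynomial $Q\in\mathbb{C}[A_i: i\in I]$ is $U_n$-invariant if replacing every $A_i$ by $\varepsilon^iA_i$ leaves $Q$ unchanged for every $\varepsilon\in U_n$. Statement. Let $Q\in\mathbb{C}[A_i: i\in I]$ be $U_n$-invariant. Then there are polynomials $W,V$ in variables $C_{ij}$ ($i,j\geq 0$) with complex coefficients, and integers $N,l_1,\dots,l_m\geq 0$, all depending only on $(b_0,\dots,b_m)$ and $Q$, such that for every $f=\sum c_{ij}X^iY^j\in\widehat{\mathcal F}(b_0,\dots,b_m)$ and every Puiseux parametrisation $(T^n,\sum_i a_iT^i)$ of $f=0$, $$V\bigl((c_{ij})\bigr)=c_{0n}^{N}\,a_{b_1}^{l_1}\cdots a_{b_m}^{l_m}\neq 0 \qquad\text{and}\qquad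 Q\bigl((a_i)_{i\in I}\bigr)=\frac{W\bigl((c_{ij})\bigr)}{V\bigl((c_{ij})\bigr)}.$$ In particular, if $f$ is normalised by $c_{0n}=1$, then the denominator is a monomial in $a_{b_1},\dots,a_{b_m}$. -/

import Mathlib

open scoped PowerSeries

namespace PlaneBranch

/-- The support of a power series `α = ∑ aᵢ Tⁱ`: the set of `i` with `aᵢ ≠ 0`. -/
def supp (α : ℂ⟦X⟧) : Set ℕ := {i | PowerSeries.coeff i α ≠ 0}

/-- `(Tⁿ, α(T))` is a Puiseux parametrisation: `n` is a positive integer, `α` has no constant term,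
and `gcd ({n} ∪ supp α) = 1`. -/
structure IsPuiseuxParametrisation (n : ℕ) (α : ℂ⟦X⟧) : Prop where
  pos : 0 < n
  constantCoeff_eq_zero : PowerSeries.constantCoeff α = 0
  setGcd_eq_one : Nat.setGcd (insert n (supp α)) = 1

/-- `e_k = gcd (b_0, …, b_k)`. -/
def e {m : ℕ} (b : Fin (m + 1) → ℕ) (k : Fin (m + 1)) : ℕ := (Finset.Iic k).gcd b

/-- `(b_0, …, b_m)` is the characteristic of `(Tⁿ, α(T))`:
`b_0 = n`, `b_{k+1} = min (supp α \ e_k ℕ)` for `0 ≤ k < m`, and `gcd (b_0, …, b_m) = 1`. -/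
structure HasCharacteristic {m : ℕ} (n : ℕ) (α : ℂ⟦X⟧) (b : Fin (m + 1) → ℕ) : Prop where
  zero : b 0 = n
  succ : ∀ k : Fin m, IsLeast {i | i ∈ supp α ∧ ¬ e b k.castSucc ∣ i} (b k.succ)
  last : e b (Fin.last m) = 1

/-- For a polynomial `w ∈ ℂ⟦X⟧[Y]` of degree `n`, the pair `(Tⁿ, α(T))` is a Puiseux
parametrisation with `w(Tⁿ, α(T)) = 0`. The map `PowerSeries.expand n` is the substitution
`X ↦ Tⁿ`. -/
def IsPuiseuxParametrisationOfPolynomial (w : Polynomial ℂ⟦X⟧) (α : ℂ⟦X⟧) : Prop :=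
  ∃ h : IsPuiseuxParametrisation w.natDegree α,
    w.eval₂ (PowerSeries.expand w.natDegree h.pos.ne' : ℂ⟦X⟧ →ₐ[ℂ] ℂ⟦X⟧).toRingHom α = 0

/-- The set `𝓕(b_0, …, b_m)` of Weierstrass polynomials (monic polynomials in `Y` over `ℂ⟦X⟧` whose
other coefficients have no constant term) of degree `b_0` that are irreducible in `ℂ⟦X, Y⟧` and have
characteristic `(b_0, …, b_m)`. Here and below `ℂ⟦X, Y⟧` is `ℂ⟦X⟧⟦Y⟧`, that is, the inner variable
is `X` and the outer one is `Y`. -/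
structure IsInClass {m : ℕ} (b : Fin (m + 1) → ℕ) (w : Polynomial ℂ⟦X⟧) : Prop where
  isWeierstrass : w.IsDistinguishedAt (IsLocalRing.maximalIdeal ℂ⟦X⟧)
  natDegree_eq : w.natDegree = b 0
  irreducible : Irreducible (w : ℂ⟦X⟧⟦X⟧)
  hasCharacteristic : ∃ α : ℂ⟦X⟧, IsPuiseuxParametrisationOfPolynomial w α ∧
    HasCharacteristic w.natDegree α b

/-- The set of irreducible `f ∈ ℂ⟦X, Y⟧` that are a unit times a Weierstrass polynomial in
`𝓕(b_0, …, b_m)`. -/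
structure IsInSeriesClass {m : ℕ} (b : Fin (m + 1) → ℕ) (f : ℂ⟦X⟧⟦X⟧) : Prop where
  irreducible : Irreducible f
  exists_weierstrass : ∃ (w : Polynomial ℂ⟦X⟧) (u : ℂ⟦X⟧⟦X⟧),
    f.IsWeierstrassFactorization w u ∧ IsInClass b w

/-- `(Tⁿ, α(T))` is a Puiseux parametrisation of the curve `f(x, y) = 0`: it is one for the
(unique) Weierstrass polynomial `w` of `f`, with `n` the degree of `w`. -/
def IsPuiseuxParametrisationOf (f : ℂ⟦X⟧⟦X⟧) (α : ℂ⟦X⟧) : Prop :=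
  ∃ (w : Polynomial ℂ⟦X⟧) (u : ℂ⟦X⟧⟦X⟧),
    f.IsWeierstrassFactorization w u ∧ IsPuiseuxParametrisationOfPolynomial w α

/-- The index set `I = e_0 ℕ₊ ∪ ⋃_{k=1}^m (e_k ℕ ∩ [b_k, ∞))`, which contains the support of every
Puiseux parametrisation of characteristic `(b_0, …, b_m)`. -/
def indexSet {m : ℕ} (b : Fin (m + 1) → ℕ) : Set ℕ :=
  {i | 0 < i ∧ e b 0 ∣ i} ∪ ⋃ k : Fin m, {i | e b k.succ ∣ i ∧ b k.succ ≤ i}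

/-- A polynomial `Q` in variables `A_i`, `i ∈ I`, is `U_n`-invariant if replacing each `A_i` by
`ε^i A_i` leaves `Q` unchanged, for every `n`-th root of unity `ε`. -/
def IsRootsOfUnityInvariant {I : Set ℕ} (n : ℕ) (Q : MvPolynomial I ℂ) : Prop :=
  ∀ ε : ℂ, ε ^ n = 1 →
    MvPolynomial.bind₁ (fun i : I => MvPolynomial.C (ε ^ (i : ℕ)) * MvPolynomial.X i) Q = Q

/-- The value of `Q` at the coefficients `(a_i)_{i ∈ I}` of `α = ∑ a_i Tⁱ`. -/
noncomputable def evalParam {I : Set ℕ} (α : ℂ⟦X⟧) (Q : MvPolynomial I ℂ) : ℂ :=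
  MvPolynomial.eval (fun i : I => PowerSeries.coeff (i : ℕ) α) Q

/-- The coefficient `c_{ij}` of `f = ∑ c_{ij} Xⁱ Yʲ`. -/
noncomputable def seriesCoeff (f : ℂ⟦X⟧⟦X⟧) (i j : ℕ) : ℂ :=
  PowerSeries.coeff i (PowerSeries.coeff j f)

/-- The value of a polynomial in variables `C_{ij}` at the coefficients `c_{ij}` of `f`. -/
noncomputable def evalSeries (f : ℂ⟦X⟧⟦X⟧) (P : MvPolynomial (ℕ × ℕ) ℂ) : ℂ :=
  MvPolynomial.eval (fun p : ℕ × ℕ => seriesCoeff f p.1 p.2) P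

end PlaneBranch

/-! Everything is regarded as a function of the pair (f, α). Let B be the algebra of functions that
become polynomials in the c_ij after multiplication by a polynomial function which is, up to a
nonzero constant, a monomial in c_0n and the a_{b_k}. The claim is that Q(a) lies in B.

Since c_0n is a unit of B, solving f = w u recursively puts the coefficients of w in B. The roots of
w(Tⁿ, Y) are the n conjugates α(ζʲT), so Newton's identities put their power sums over B; the d-th
one is n times the part of αᵈ with exponents in nℕ. Hence every element of the algebra R generated
by α over the series in Tⁿ with coefficients in B has its coefficients at multiples of n in B.

A single a_i depends on the choice of conjugate, but it is a leading coefficient of an element of R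
in an order ≡ i mod n (`isLeading_coeff`). The proof is by induction on i. Let β be the truncation
of α below i and d > 0 minimal such that T ↦ ζᵈT fixes β. Then ∏_{j<d} (α − β(ζʲT)) is the value at
α of a polynomial with rotation-invariant coefficients, which by induction are series in Tⁿ over B.
The factor j = 0 starts with a_i Tⁱ, each other one with a nonzero constant times some a_{b_k}
T^{b_k}. The product ν of these other leading coefficients satisfies νⁿ ∈ B and is a monomial, so it
can be cancelled: this is why only the a_{b_k} enter the denominator.

Invariance of Q means that all its monomials have weight divisible by n, and a leading coefficient
in such an order lies in B. -/

namespace PlaneBranch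

/-! ### Localisation at monomial denominators -/

section LocalizedSubalgebra

variable {R : Type*} [CommRing R] [Algebra ℂ R]

/-- The subalgebra of elements that can be multiplied into `P` by an element of `P ∩ M`. -/
def localizedSubalgebra (P : Subalgebra ℂ R) (M : Submonoid R) : Subalgebra ℂ R where
  carrier := {φ | ∃ μ ∈ M, μ ∈ P ∧ μ * φ ∈ P}
  mul_mem' := by
    rintro φ ψ ⟨μ, hμ, hμP, h⟩ ⟨ν, hν, hνP, h'⟩
    refine ⟨μ * ν, M.mul_mem hμ hν, P.mul_mem hμP hνP, ?_⟩
    rw [mul_mul_mul_comm]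
    exact P.mul_mem h h'
  add_mem' := by
    rintro φ ψ ⟨μ, hμ, hμP, h⟩ ⟨ν, hν, hνP, h'⟩
    refine ⟨μ * ν, M.mul_mem hμ hν, P.mul_mem hμP hνP, ?_⟩
    have : μ * ν * (φ + ψ) = ν * (μ * φ) + μ * (ν * ψ) := by ring
    rw [this]
    exact P.add_mem (P.mul_mem hνP h) (P.mul_mem hμP h')
  algebraMap_mem' c := ⟨1, M.one_mem, P.one_mem, by simp⟩

theorem le_localizedSubalgebra (P : Subalgebra ℂ R) (M : Submonoid R) :
    P ≤ localizedSubalgebra P M :=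
  fun _ hφ => ⟨1, M.one_mem, P.one_mem, by simpa using hφ⟩

/-- If `μ * φ ∈ P`, then `μ * φ` is itself an admissible denominator, and it carries `ψ` to `μ`.
Only `φ ∈ localizedSubalgebra P M` is needed, not `φ ∈ P`. -/
theorem mem_localizedSubalgebra_of_mul_eq_one {P : Subalgebra ℂ R} {M : Submonoid R} {φ ψ : R}
    (hφM : φ ∈ M) (hφ : φ ∈ localizedSubalgebra P M) (h : φ * ψ = 1) :
    ψ ∈ localizedSubalgebra P M := by
  obtain ⟨μ, hμ, hμP, hμφ⟩ := hφ
  exact ⟨μ * φ, M.mul_mem hμ hφM, hμφ, by rwa [mul_assoc, h, mul_one]⟩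

end LocalizedSubalgebra

/-! ### Power sums from coefficients -/

section Polynomial

variable {R : Type*} [CommRing R]

theorem coeff_prod_X_sub_C_mem (S : Subring R) {κ : Type*} (s : Finset κ) (β : κ → R)
    (hβ : ∀ j ∈ s, β j ∈ S) (k : ℕ) :
    (∏ j ∈ s, (Polynomial.X - Polynomial.C (β j))).coeff k ∈ S := by
  have h : ∏ j ∈ s, (Polynomial.X - Polynomial.C (β j)) ∈ Polynomial.lifts S.subtype := by
    refine Subsemiring.prod_mem _ fun j hj => ?_
    refine (Polynomial.lifts_iff_coeff_lifts _).2 fun k => ?_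
    rw [Polynomial.coeff_sub, Polynomial.coeff_X, Polynomial.coeff_C]
    have h1 : (if 1 = k then 1 else 0 : R) - (if k = 0 then β j else 0) ∈ S := by
      refine S.sub_mem ?_ ?_ <;> split_ifs
      exacts [S.one_mem, S.zero_mem, hβ j hj, S.zero_mem]
    exact ⟨⟨_, h1⟩, rfl⟩
  obtain ⟨a, ha⟩ := (Polynomial.lifts_iff_coeff_lifts _).1 h k
  rw [← ha]
  exact a.2

/-- Newton's identities, used in the direction that expresses power sums through elementary
symmetric functions and needs no division. -/
theorem sum_pow_mem_of_coeff_prod_X_sub_C_mem (S : Subring R) {n : ℕ} (β : Fin n → R)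
    (h : ∀ k, (∏ j, (Polynomial.X - Polynomial.C (β j))).coeff k ∈ S) (d : ℕ) :
    ∑ j, β j ^ d ∈ S := by
  have hneg : ∀ k : ℕ, (-1 : R) ^ k ∈ S := fun k => S.pow_mem (S.neg_mem S.one_mem) k
  have hesymm : ∀ k, MvPolynomial.aeval β (MvPolynomial.esymm (Fin n) ℤ k) ∈ S := by
    intro k
    rw [MvPolynomial.aeval_esymm_eq_multiset_esymm]
    rcases le_or_gt k n with hk | hk
    · have hcoeff := Multiset.prod_X_sub_C_coeff (Finset.univ.val.map β) (k := n - k) (by simp)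
      simp only [Multiset.card_map, Finset.card_val, Finset.card_univ, Fintype.card_fin,
        Nat.sub_sub_self hk, Multiset.map_map] at hcoeff
      have hmem := S.mul_mem (hneg k) (h (n - k))
      have hprod : (∏ j, (Polynomial.X - Polynomial.C (β j))) =
        (Multiset.map ((fun t => Polynomial.X - Polynomial.C t) ∘ β) Finset.univ.val).prod := rfl
      rw [hprod, hcoeff, ← mul_assoc, ← mul_pow] at hmem
      simpa using hmem
    · have : (Finset.univ.val.map β).esymm k = 0 := by
        rw [Multiset.esymm, Multiset.powersetCard_eq_empty _ (by simpa using hk)]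
        simp
      rw [this]
      exact S.zero_mem
  have hpsum : ∀ k, MvPolynomial.aeval β (MvPolynomial.psum (Fin n) ℤ k) ∈ S := by
    intro k
    induction k using Nat.strong_induction_on with
    | _ k ih =>
      rcases Nat.eq_zero_or_pos k with rfl | hk
      · simp
      · rw [MvPolynomial.psum_eq_mul_esymm_sub_sum _ _ _ hk, map_sub, map_sum]
        refine S.sub_mem ?_ (S.sum_mem fun a ha => ?_)
        · simpa using S.mul_mem (S.mul_mem (hneg (k + 1)) (natCast_mem S k)) (hesymm k)
        · rw [Finset.mem_filter, Finset.HasAntidiagonal.mem_antidiagonal] at ha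
          have hlt : a.2 < k := by have := ha.2.1; omega
          simpa using S.mul_mem (S.mul_mem (hneg a.1) (hesymm a.1)) (ih _ hlt)
  simpa [MvPolynomial.psum] using hpsum d

end Polynomial

/-! ### The algebra generated by the branch over series in Tⁿ -/

section Families

variable {ι : Type*}

/-- Families of power series in `Tⁿ` whose coefficients, as functions of the parameter, are
in `B`. -/
def periodicFamilies (n : ℕ) (B : Subalgebra ℂ (ι → ℂ)) : Subalgebra ℂ (ι → ℂ⟦X⟧) where
  carrier := {F | ∀ l, (fun x => PowerSeries.coeff l (F x)) ∈ B ∧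
    (¬ n ∣ l → ∀ x, PowerSeries.coeff l (F x) = 0)}
  mul_mem' := by
    intro F G hF hG l
    refine ⟨?_, fun hl x => ?_⟩
    · have : (fun x => PowerSeries.coeff l ((F * G) x)) = ∑ p ∈ Finset.HasAntidiagonal.antidiagonal l,
          (fun x => PowerSeries.coeff p.1 (F x)) * (fun x => PowerSeries.coeff p.2 (G x)) := by
        ext x
        simp [PowerSeries.coeff_mul]
      rw [this]
      exact B.sum_mem fun p _ => B.mul_mem (hF p.1).1 (hG p.2).1
    · rw [Pi.mul_apply, PowerSeries.coeff_mul]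
      refine Finset.sum_eq_zero fun p hp => ?_
      rw [Finset.HasAntidiagonal.mem_antidiagonal] at hp
      by_cases h1 : n ∣ p.1
      · rw [(hG p.2).2 (fun h2 => hl (hp ▸ dvd_add h1 h2)) x, mul_zero]
      · rw [(hF p.1).2 h1 x, zero_mul]
  add_mem' := by
    intro F G hF hG l
    refine ⟨?_, fun hl x => ?_⟩
    · convert B.add_mem (hF l).1 (hG l).1 using 1
      ext x
      simp
    · simp [(hF l).2 hl x, (hG l).2 hl x]
  algebraMap_mem' c := by
    intro l
    have h : ∀ x : ι, PowerSeries.coeff l (algebraMap ℂ (ι → ℂ⟦X⟧) c x) =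
        if l = 0 then c else 0 := by
      intro x
      rw [Pi.algebraMap_apply, PowerSeries.algebraMap_apply, PowerSeries.coeff_C]
      rfl
    simp only [h]
    refine ⟨B.algebraMap_mem (if l = 0 then c else 0), fun hl _ => if_neg ?_⟩
    rintro rfl
    exact hl (dvd_zero n)

/-- The algebra generated by the family `α` over `periodicFamilies n B`. -/
noncomputable def branchAlgebra (n : ℕ) (B : Subalgebra ℂ (ι → ℂ)) (α : ι → ℂ⟦X⟧) :
    Subalgebra ℂ (ι → ℂ⟦X⟧) :=
  Algebra.adjoin ℂ (insert α (periodicFamilies n B : Set (ι → ℂ⟦X⟧)))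

variable {n : ℕ} {B : Subalgebra ℂ (ι → ℂ)} {α : ι → ℂ⟦X⟧}

theorem self_mem_branchAlgebra : α ∈ branchAlgebra n B α :=
  Algebra.subset_adjoin (Set.mem_insert _ _)

theorem mem_branchAlgebra_of_mem_periodicFamilies {F : ι → ℂ⟦X⟧}
    (hF : F ∈ periodicFamilies n B) : F ∈ branchAlgebra n B α :=
  Algebra.subset_adjoin (Set.mem_insert_of_mem _ hF)

theorem branchAlgebra_induction {p : (ι → ℂ⟦X⟧) → Prop}
    (monomial : ∀ c ∈ periodicFamilies n B, ∀ d : ℕ, p (c * α ^ d)) (zero : p 0)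
    (add : ∀ F G, p F → p G → p (F + G)) (smul : ∀ (c : ℂ) F, p F → p (c • F))
    {F : ι → ℂ⟦X⟧} (hF : F ∈ branchAlgebra n B α) : p F := by
  have hF' : F ∈ Subalgebra.toSubmodule (branchAlgebra n B α) := hF
  rw [branchAlgebra, Algebra.adjoin_eq_span] at hF'
  refine Submodule.span_induction (p := fun F _ => p F) (fun F hF => ?_) zero
    (fun F G _ _ => add F G) (fun c F _ => smul c F) hF'
  obtain ⟨c, hc, d, rfl⟩ : ∃ c ∈ periodicFamilies n B, ∃ d : ℕ, F = c * α ^ d := by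
    refine Submonoid.closure_induction
      (motive := fun F _ => ∃ c ∈ periodicFamilies n B, ∃ d : ℕ, F = c * α ^ d) ?_ ?_ ?_ hF
    · rintro F (rfl | hF)
      · exact ⟨1, one_mem _, 1, by simp⟩
      · exact ⟨F, hF, 0, by simp⟩
    · exact ⟨1, one_mem _, 0, by simp⟩
    · rintro _ _ _ _ ⟨c, hc, d, rfl⟩ ⟨c', hc', d', rfl⟩
      exact ⟨c * c', mul_mem hc hc', d + d', by ring⟩
  exact monomial c hc d

/-- In a product `c * α ^ d` with `c` a series in Tⁿ, the coefficient at a multiple of `n` involves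
only coefficients of `α ^ d` at multiples of `n`. -/
theorem coeff_mem_of_mem_branchAlgebra
    (hα : ∀ d q, (fun x => PowerSeries.coeff (n * q) (α x ^ d)) ∈ B) {F : ι → ℂ⟦X⟧}
    (hF : F ∈ branchAlgebra n B α) (q : ℕ) :
    (fun x => PowerSeries.coeff (n * q) (F x)) ∈ B := by
  refine branchAlgebra_induction
    (p := fun F => (fun x => PowerSeries.coeff (n * q) (F x)) ∈ B) (fun c hc d => ?_) ?_
    (fun F G hF hG => ?_) (fun c F hF => ?_) hF
  · have : (fun x => PowerSeries.coeff (n * q) ((c * α ^ d) x)) =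
        ∑ a ∈ Finset.HasAntidiagonal.antidiagonal (n * q),
          (fun x => PowerSeries.coeff a.1 (c x)) *
            (fun x => PowerSeries.coeff a.2 (α x ^ d)) := by
      ext x
      simp [PowerSeries.coeff_mul]
    rw [this]
    refine B.sum_mem fun a ha => ?_
    rw [Finset.HasAntidiagonal.mem_antidiagonal] at ha
    by_cases h1 : n ∣ a.1
    · obtain ⟨r, hr⟩ := (Nat.dvd_add_right h1).1 (ha ▸ dvd_mul_right n q)
      rw [hr]
      exact B.mul_mem (hc _).1 (hα d r)
    · convert B.zero_mem using 1
      ext x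
      simp [(hc a.1).2 h1 x]
  · convert B.zero_mem using 1
    ext x
    simp
  · convert B.add_mem hF hG using 1
    ext x
    simp
  · convert B.smul_mem hF c using 1
    ext x
    simp

end Families

/-! ### Leading coefficients graded modulo n -/

section Leading

variable {ι : Type*}

/-- `φ` is the leading coefficient, in an order congruent to `d` modulo `n`, of a family in `A`
(where `φ` is allowed to vanish). -/
def IsLeading (A : Subalgebra ℂ (ι → ℂ⟦X⟧)) (n d : ℕ) (φ : ι → ℂ) : Prop :=
  ∃ h, h ≡ d [MOD n] ∧ ∃ G : ι → ℂ⟦X⟧,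
    (fun x => PowerSeries.X ^ h * G x) ∈ A ∧ ∀ x, PowerSeries.constantCoeff (G x) = φ x

variable {A : Subalgebra ℂ (ι → ℂ⟦X⟧)} {n d d' : ℕ} {φ ψ : ι → ℂ}

theorem IsLeading.congr (h : IsLeading A n d φ) (hd : d ≡ d' [MOD n]) : IsLeading A n d' φ := by
  obtain ⟨k, hk, G⟩ := h
  exact ⟨k, hk.trans hd, G⟩

theorem IsLeading.mul (h : IsLeading A n d φ) (h' : IsLeading A n d' ψ) :
    IsLeading A n (d + d') (φ * ψ) := by
  obtain ⟨k, hk, G, hG, hφ⟩ := h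
  obtain ⟨k', hk', G', hG', hψ⟩ := h'
  refine ⟨k + k', hk.add hk', G * G', ?_, fun x => by simp [hφ, hψ]⟩
  convert A.mul_mem hG hG' using 1
  ext1 x
  simp only [Pi.mul_apply]
  ring

theorem isLeading_one : IsLeading A n 0 (1 : ι → ℂ) :=
  ⟨0, rfl, 1, by convert A.one_mem using 1; ext1 x; simp, by simp⟩

theorem isLeading_zero : IsLeading A n d (0 : ι → ℂ) :=
  ⟨d, rfl, 0, by convert A.zero_mem using 1; ext1 x; simp, by simp⟩

theorem IsLeading.smul (h : IsLeading A n d φ) (c : ℂ) : IsLeading A n d (c • φ) := by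
  obtain ⟨k, hk, G, hG, hφ⟩ := h
  refine ⟨k, hk, c • G, ?_, fun x => ?_⟩
  · convert A.smul_mem hG c using 1
    ext1 x
    simp
  · rw [Pi.smul_apply, PowerSeries.smul_eq_C_mul]
    simp [hφ]

theorem IsLeading.prod {κ : Type*} (s : Finset κ) (d : κ → ℕ) (φ : κ → ι → ℂ)
    (h : ∀ j ∈ s, IsLeading A n (d j) (φ j)) :
    IsLeading A n (∑ j ∈ s, d j) (∏ j ∈ s, φ j) := by
  classical
  induction s using Finset.induction_on with
  | empty => simpa using isLeading_one
  | insert a s ha ih =>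
    rw [Finset.sum_insert ha, Finset.prod_insert ha]
    exact (h a (Finset.mem_insert_self a s)).mul
      (ih fun j hj => h j (Finset.mem_insert_of_mem hj))

theorem IsLeading.pow (h : IsLeading A n d φ) (k : ℕ) : IsLeading A n (k * d) (φ ^ k) := by
  simpa using IsLeading.prod (Finset.range k) (fun _ => d) (fun _ => φ) fun _ _ => h

theorem IsLeading.add (hX : (fun _ => PowerSeries.X ^ n) ∈ A) (h : IsLeading A n d φ)
    (h' : IsLeading A n d ψ) : IsLeading A n d (φ + ψ) := by
  obtain ⟨k, hk, G, hG, hφ⟩ := h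
  obtain ⟨k', hk', G', hG', hψ⟩ := h'
  have hkk : k % n = k' % n := hk.trans hk'.symm
  have e1 := Nat.div_add_mod k n
  have e2 := Nat.div_add_mod k' n
  -- Both families are multiplied by powers of Tⁿ to reach a common order; the quotients are swapped
  -- so that no comparison of `k` and `k'` is needed.
  refine ⟨n * (k' / n) + k, ?_, G + G', ?_, fun x => by simp [hφ, hψ]⟩
  · refine Nat.ModEq.trans ?_ hk
    simp [Nat.ModEq]
  · convert A.add_mem (A.mul_mem (A.pow_mem hX (k' / n)) hG)
      (A.mul_mem (A.pow_mem hX (k / n)) hG') using 1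
    ext1 x
    have e3 : n * (k / n) + k' = n * (k' / n) + k := by omega
    simp only [Pi.add_apply, Pi.mul_apply, Pi.pow_apply, ← pow_mul, ← mul_assoc, ← pow_add, e3,
      mul_add]

theorem IsLeading.sum (hX : (fun _ => PowerSeries.X ^ n) ∈ A) {κ : Type*} (s : Finset κ)
    (φ : κ → ι → ℂ) (h : ∀ j ∈ s, IsLeading A n d (φ j)) : IsLeading A n d (∑ j ∈ s, φ j) := by
  classical
  induction s using Finset.induction_on with
  | empty => simpa using isLeading_zero
  | insert a s ha ih =>
    rw [Finset.sum_insert ha]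
    exact (h a (Finset.mem_insert_self a s)).add hX
      (ih fun j hj => h j (Finset.mem_insert_of_mem hj))

/-- Families whose `Tʲ`-coefficient is a leading coefficient of degree `j`, for every `j`. -/
def gradedFamilies (A : Subalgebra ℂ (ι → ℂ⟦X⟧)) (n : ℕ)
    (hX : (fun _ => PowerSeries.X ^ n) ∈ A) : Subring (ι → ℂ⟦X⟧) where
  carrier := {F | ∀ j, IsLeading A n j (fun x => PowerSeries.coeff j (F x))}
  mul_mem' := by
    intro F G hF hG l
    have : (fun x => PowerSeries.coeff l ((F * G) x)) =
        ∑ p ∈ Finset.HasAntidiagonal.antidiagonal l,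
          (fun x => PowerSeries.coeff p.1 (F x)) * (fun x => PowerSeries.coeff p.2 (G x)) := by
      ext x
      simp [PowerSeries.coeff_mul]
    rw [this]
    refine IsLeading.sum hX _ _ fun p hp => ?_
    rw [Finset.HasAntidiagonal.mem_antidiagonal] at hp
    exact hp ▸ (hF p.1).mul (hG p.2)
  one_mem' := by
    intro j
    rcases eq_or_ne j 0 with rfl | hj
    · convert isLeading_one using 1
      ext x
      simp
    · convert isLeading_zero using 1
      ext x
      simp [PowerSeries.coeff_one, hj]
  add_mem' := by
    intro F G hF hG l
    convert (hF l).add hX (hG l) using 1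
    ext x
    simp
  zero_mem' := by
    intro j
    convert isLeading_zero using 1
    ext x
    simp
  neg_mem' := by
    intro F hF j
    convert (hF j).smul (-1) using 1
    ext x
    simp

variable {B : Subalgebra ℂ (ι → ℂ)} {α : ι → ℂ⟦X⟧}

theorem X_pow_mem_periodicFamilies :
    (fun _ => PowerSeries.X ^ n : ι → ℂ⟦X⟧) ∈ periodicFamilies n B := by
  intro l
  simp only [PowerSeries.coeff_X_pow]
  refine ⟨B.algebraMap_mem (if l = n then 1 else 0), fun hl _ => if_neg ?_⟩
  rintro rfl
  exact hl dvd_rfl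

theorem mem_of_isLeading (hα : ∀ d q, (fun x => PowerSeries.coeff (n * q) (α x ^ d)) ∈ B)
    (h : IsLeading (branchAlgebra n B α) n d φ) (hd : n ∣ d) : φ ∈ B := by
  obtain ⟨k, hk, G, hG, hφ⟩ := h
  obtain ⟨q, rfl⟩ := (hk.dvd_iff dvd_rfl).2 hd
  convert coeff_mem_of_mem_branchAlgebra hα hG q using 1
  ext x
  rw [← hφ, PowerSeries.coeff_X_pow_mul']
  simp

theorem isLeading_of_mem (h : φ ∈ B) : IsLeading (branchAlgebra n B α) n 0 φ := by
  refine ⟨0, rfl, fun x => PowerSeries.C (φ x), mem_branchAlgebra_of_mem_periodicFamilies ?_,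
    by simp⟩
  intro l
  simp only [pow_zero, one_mul, PowerSeries.coeff_C]
  refine ⟨?_, fun hl _ => if_neg ?_⟩
  · split_ifs
    exacts [h, B.zero_mem]
  · rintro rfl
    exact hl (dvd_zero n)

/-- Rotation `T ↦ ζT` of families. -/
noncomputable def rotate (ι : Type*) (ζ : ℂ) : (ι → ℂ⟦X⟧) →+* (ι → ℂ⟦X⟧) :=
  RingHom.pi fun x => (PowerSeries.rescale ζ).comp (Pi.evalRingHom (fun _ => ℂ⟦X⟧) x)

theorem rotate_apply (ζ : ℂ) (F : ι → ℂ⟦X⟧) (x : ι) :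
    rotate ι ζ F x = PowerSeries.rescale ζ (F x) := rfl

/-- Invariance under a primitive root kills the coefficients outside nℕ; the remaining ones are
leading coefficients in orders divisible by `n`, hence in `B`. -/
theorem mem_periodicFamilies_of_rotate_eq
    (hα : ∀ d q, (fun x => PowerSeries.coeff (n * q) (α x ^ d)) ∈ B)
    {ζ : ℂ} (hζ : IsPrimitiveRoot ζ n) {F : ι → ℂ⟦X⟧}
    (hF : ∀ j, IsLeading (branchAlgebra n B α) n j (fun x => PowerSeries.coeff j (F x)))
    (hrot : rotate ι ζ F = F) : F ∈ periodicFamilies n B := by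
  have hzero : ∀ l, ¬ n ∣ l → ∀ x, PowerSeries.coeff l (F x) = 0 := by
    intro l hl x
    have h1 := congrArg (PowerSeries.coeff l) (congrFun hrot x)
    rw [rotate_apply, PowerSeries.coeff_rescale] at h1
    have h2 : (ζ ^ l - 1) * PowerSeries.coeff l (F x) = 0 := by rw [sub_mul, h1, one_mul, sub_self]
    refine (mul_eq_zero.1 h2).resolve_left fun h3 => hl ?_
    exact (hζ.pow_eq_one_iff_dvd l).1 (sub_eq_zero.1 h3)
  intro l
  refine ⟨?_, hzero l⟩
  by_cases hl : n ∣ l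
  · exact mem_of_isLeading hα (hF l) hl
  · convert B.zero_mem using 1
    ext x
    simp [hzero l hl x]

/-- If the family `β` is graded and `T ↦ ζᵈT` fixes it, then the product of the differences
of `α` and the first `d` rotations of `β` is in the algebra of `α`. -/
theorem prod_sub_rotate_mem_branchAlgebra
    (hα : ∀ d q, (fun x => PowerSeries.coeff (n * q) (α x ^ d)) ∈ B)
    {ζ : ℂ} (hζ : IsPrimitiveRoot ζ n) {β : ι → ℂ⟦X⟧}
    (hβ : ∀ j, IsLeading (branchAlgebra n B α) n j (fun x => PowerSeries.coeff j (β x)))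
    (hd : 0 < d) (hrot : rotate ι (ζ ^ d) β = β) :
    ∏ j ∈ Finset.range d, (α - rotate ι (ζ ^ j) β) ∈ branchAlgebra n B α := by
  have hX : (fun _ => PowerSeries.X ^ n) ∈ branchAlgebra n B α :=
    mem_branchAlgebra_of_mem_periodicFamilies X_pow_mem_periodicFamilies
  set g : Polynomial (ι → ℂ⟦X⟧) := ∏ j ∈ Finset.range d,
    (Polynomial.X - Polynomial.C (rotate ι (ζ ^ j) β)) with hg
  have hgr : ∀ k, g.coeff k ∈ gradedFamilies (branchAlgebra n B α) n hX := by
    refine coeff_prod_X_sub_C_mem _ _ _ fun j _ l => ?_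
    convert (hβ l).smul ((ζ ^ j) ^ l) using 1
    ext x
    simp [rotate_apply, PowerSeries.coeff_rescale]
  -- Rotation by `ζ` permutes the factors cyclically: the last one returns to the first because `ζ ^
  -- d` fixes `β`.
  have hmap : g.map (rotate ι ζ) = g := by
    obtain ⟨d, rfl⟩ : ∃ k, d = k + 1 := ⟨d - 1, by omega⟩
    have hstep : ∀ j, rotate ι ζ (rotate ι (ζ ^ j) β) = rotate ι (ζ ^ (j + 1)) β := by
      intro j
      ext1 x
      simp only [rotate_apply, PowerSeries.rescale_rescale, pow_succ]
    rw [hg, Polynomial.map_prod]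
    simp only [Polynomial.map_sub, Polynomial.map_X, Polynomial.map_C, hstep]
    rw [Finset.prod_range_succ, Finset.prod_range_succ', hrot]
    congr 3
    ext1 x
    simp [rotate_apply]
  have hcoeff : ∀ k, g.coeff k ∈ periodicFamilies n B := fun k =>
    mem_periodicFamilies_of_rotate_eq hα hζ (hgr k) (by rw [← Polynomial.coeff_map, hmap])
  have heval : ∏ j ∈ Finset.range d, (α - rotate ι (ζ ^ j) β) = g.eval α := by
    simp [hg, Polynomial.eval_prod]
  rw [heval, Polynomial.eval_eq_sum_range]
  exact Subalgebra.sum_mem _ fun k _ => mul_mem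
    (mem_branchAlgebra_of_mem_periodicFamilies (hcoeff k)) (pow_mem self_mem_branchAlgebra k)

end Leading

/-! ### Recovering a coefficient from the preceding ones -/

section Recover

variable {ι : Type*} {n d i : ℕ} {B : Subalgebra ℂ (ι → ℂ)} {α : ι → ℂ⟦X⟧} {ζ : ℂ}

/-- The family of truncations of `α` below degree `i`. -/
noncomputable def truncation (α : ι → ℂ⟦X⟧) (i : ℕ) (x : ι) : ℂ⟦X⟧ :=
  PowerSeries.mk fun l => if l < i then PowerSeries.coeff l (α x) else 0

theorem coeff_sub_rotate_truncation (ζ : ℂ) (i l : ℕ) (x : ι) :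
    PowerSeries.coeff l ((α - rotate ι ζ (truncation α i)) x) =
      if l < i then (1 - ζ ^ l) * PowerSeries.coeff l (α x) else PowerSeries.coeff l (α x) := by
  rw [Pi.sub_apply, map_sub, rotate_apply, PowerSeries.coeff_rescale, truncation,
    PowerSeries.coeff_mk]
  split_ifs <;> ring

theorem exists_eq_X_pow_mul (F : ι → ℂ⟦X⟧) (h : ℕ)
    (hF : ∀ l < h, ∀ x, PowerSeries.coeff l (F x) = 0) :
    ∃ G : ι → ℂ⟦X⟧, (∀ x, F x = PowerSeries.X ^ h * G x) ∧
      ∀ x, PowerSeries.constantCoeff (G x) = PowerSeries.coeff h (F x) := by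
  have : ∀ x, ∃ G, F x = PowerSeries.X ^ h * G := fun x =>
    PowerSeries.X_pow_dvd_iff.2 fun l hl => hF l hl x
  choose G hG using this
  refine ⟨G, hG, fun x => ?_⟩
  rw [hG, PowerSeries.coeff_X_pow_mul']
  simp

/-- If the coefficients below `i` are leading coefficients, then the `i`-th coefficient becomes
one after multiplication by leading coefficients of differences of conjugates. -/
theorem isLeading_coeff_mul_prod
    (hα : ∀ d q, (fun x => PowerSeries.coeff (n * q) (α x ^ d)) ∈ B)
    (hζ : IsPrimitiveRoot ζ n)
    (hlow : ∀ l < i, IsLeading (branchAlgebra n B α) n l (fun x => PowerSeries.coeff l (α x)))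
    (hd : 0 < d) (hdi : ∀ l < i, ∀ x, PowerSeries.coeff l (α x) ≠ 0 → n ∣ d * l)
    {r : ℕ → ℕ} (hri : ∀ j, 0 < j → j < d → r j < i)
    (hr : ∀ j, 0 < j → j < d → ∀ l < r j, ∀ x, PowerSeries.coeff l (α x) ≠ 0 → n ∣ j * l) :
    IsLeading (branchAlgebra n B α) n (i + ∑ j ∈ Finset.Ico 1 d, r j)
      ((fun x => PowerSeries.coeff i (α x)) * ∏ j ∈ Finset.Ico 1 d,
        fun x => (1 - ζ ^ (j * r j)) * PowerSeries.coeff (r j) (α x)) := by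
  have hmem := prod_sub_rotate_mem_branchAlgebra (β := truncation α i) hα hζ
    (by
      intro l
      rcases lt_or_ge l i with hl | hl
      · simpa [truncation, hl] using hlow l hl
      · convert isLeading_zero using 1
        ext x
        simp [truncation, hl.not_gt])
    hd
    (by
      ext x l
      rw [rotate_apply, PowerSeries.coeff_rescale, truncation, PowerSeries.coeff_mk]
      split_ifs with hl
      · by_cases h0 : PowerSeries.coeff l (α x) = 0
        · simp [h0]
        · rw [← pow_mul, (hζ.pow_eq_one_iff_dvd _).2 (hdi l hl x h0), one_mul]
      · simp)
  -- A lower bound for the order of the j-th factor: the unrotated truncation agrees with `α` below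
  -- `i`, the j-th rotation agrees with it below `r j`.
  set h : ℕ → ℕ := fun j => if j = 0 then i else r j with hh
  have hfac : ∀ j, ∃ G : ι → ℂ⟦X⟧, j < d →
      (∀ x, (α - rotate ι (ζ ^ j) (truncation α i)) x = PowerSeries.X ^ h j * G x) ∧
      ∀ x, PowerSeries.constantCoeff (G x) =
        PowerSeries.coeff (h j) ((α - rotate ι (ζ ^ j) (truncation α i)) x) := by
    intro j
    by_cases hj : j < d
    · obtain ⟨G, hG⟩ := exists_eq_X_pow_mul (α - rotate ι (ζ ^ j) (truncation α i)) (h j) (by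
        intro l hl x
        rw [coeff_sub_rotate_truncation]
        rcases Nat.eq_zero_or_pos j with rfl | hj0
        · have : l < i := by simpa [hh] using hl
          simp [this]
        · have hl' : l < r j := by simpa [hh, hj0.ne'] using hl
          rw [if_pos (hl'.trans (hri j hj0 hj))]
          by_cases h0 : PowerSeries.coeff l (α x) = 0
          · simp [h0]
          · rw [← pow_mul, (hζ.pow_eq_one_iff_dvd _).2 (hr j hj0 hj l hl' x h0), sub_self,
              zero_mul])
      exact ⟨G, fun _ => hG⟩
    · exact ⟨0, fun h => absurd h hj⟩
  choose G hG using hfac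
  have hsum : ∑ j ∈ Finset.range d, h j = i + ∑ j ∈ Finset.Ico 1 d, r j := by
    rw [Finset.range_eq_Ico, Finset.sum_eq_sum_Ico_succ_bot hd]
    congr 1
    exact Finset.sum_congr rfl fun j hj => if_neg (by rw [Finset.mem_Ico] at hj; omega)
  refine ⟨_, Nat.ModEq.refl _, ∏ j ∈ Finset.range d, G j, ?_, fun x => ?_⟩
  · convert hmem using 1
    ext1 x
    rw [Finset.prod_apply, Finset.prod_apply, ← hsum, ← Finset.prod_pow_eq_pow_sum,
      ← Finset.prod_mul_distrib]
    exact Finset.prod_congr rfl fun j hj => ((hG j (Finset.mem_range.1 hj)).1 x).symm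
  · rw [Finset.prod_apply, map_prod, Finset.range_eq_Ico, Finset.prod_eq_prod_Ico_succ_bot hd,
      Pi.mul_apply, Finset.prod_apply]
    congr 1
    · rw [(hG 0 hd).2, coeff_sub_rotate_truncation]
      simp [hh]
    · refine Finset.prod_congr rfl fun j hj => ?_
      rw [Finset.mem_Ico] at hj
      have hj0 : j ≠ 0 := by omega
      rw [(hG j hj.2).2, coeff_sub_rotate_truncation]
      simp [hh, hj0, hri j (by omega) hj.2, pow_mul]

/-- The extra factor in `isLeading_coeff_mul_prod` can be removed, since its n-th power is a unit of
`B`. -/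
theorem isLeading_coeff_of_lt
    (hα : ∀ d q, (fun x => PowerSeries.coeff (n * q) (α x ^ d)) ∈ B) (hn : 0 < n)
    (hζ : IsPrimitiveRoot ζ n)
    {M : Submonoid (ι → ℂ)} (hM : ∀ φ ∈ M, ∀ x, φ x ≠ 0) (hMB : ∀ φ ∈ M, φ ∈ B → φ⁻¹ ∈ B)
    (hMC : ∀ c : ℂ, c ≠ 0 → (fun _ => c) ∈ M)
    (hlow : ∀ l < i, IsLeading (branchAlgebra n B α) n l (fun x => PowerSeries.coeff l (α x)))
    (hd : 0 < d) (hdi : ∀ l < i, ∀ x, PowerSeries.coeff l (α x) ≠ 0 → n ∣ d * l)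
    (hr : ∀ j, 0 < j → j < d → ∃ r < i, ¬ n ∣ j * r ∧ (fun x => PowerSeries.coeff r (α x)) ∈ M ∧
      ∀ l < r, ∀ x, PowerSeries.coeff l (α x) ≠ 0 → n ∣ j * l) :
    IsLeading (branchAlgebra n B α) n i (fun x => PowerSeries.coeff i (α x)) := by
  have hr' : ∀ j, ∃ r, 0 < j → j < d → r < i ∧ ¬ n ∣ j * r ∧
      (fun x => PowerSeries.coeff r (α x)) ∈ M ∧
      ∀ l < r, ∀ x, PowerSeries.coeff l (α x) ≠ 0 → n ∣ j * l := by
    intro j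
    by_cases hj : 0 < j ∧ j < d
    · obtain ⟨r, hr⟩ := hr j hj.1 hj.2
      exact ⟨r, fun _ _ => hr⟩
    · exact ⟨0, fun h1 h2 => absurd ⟨h1, h2⟩ hj⟩
  choose r hr using hr'
  have key := isLeading_coeff_mul_prod hα hζ hlow hd hdi (fun j h1 h2 => (hr j h1 h2).1)
    (fun j h1 h2 => (hr j h1 h2).2.2.2)
  set ν : ι → ℂ := ∏ j ∈ Finset.Ico 1 d,
    fun x => (1 - ζ ^ (j * r j)) * PowerSeries.coeff (r j) (α x) with hν
  set s : ℕ := ∑ j ∈ Finset.Ico 1 d, r j with hs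
  have hνM : ν ∈ M := by
    refine M.prod_mem fun j hj => ?_
    rw [Finset.mem_Ico] at hj
    refine M.mul_mem (hMC _ fun h => (hr j hj.1 hj.2).2.1 ?_) (hr j hj.1 hj.2).2.2.1
    exact (hζ.pow_eq_one_iff_dvd _).1 (sub_eq_zero.1 h).symm
  have hνlead : IsLeading (branchAlgebra n B α) n s ν := by
    refine IsLeading.prod _ _ _ fun j hj => ?_
    rw [Finset.mem_Ico] at hj
    exact (hlow _ (hr j hj.1 hj.2).1).smul (1 - ζ ^ (j * r j))
  -- `ν` itself need not lie in `B`, but `ν ^ n` is leading in the order `n * s`.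
  have hνB : (ν ^ n)⁻¹ ∈ B :=
    hMB _ (M.pow_mem hνM n) (mem_of_isLeading hα (hνlead.pow n) (dvd_mul_right n s))
  -- Here a_i = (a_i ν) · ν^(n-1) · (νⁿ)⁻¹, and the orders add up to `i + n * s`.
  have := ((key.mul (hνlead.pow (n - 1))).mul (isLeading_of_mem hνB)).congr (d' := i) (by
    have : i + s + (n - 1) * s + 0 = i + n * s := by
      obtain ⟨k, rfl⟩ : ∃ k, n = k + 1 := ⟨n - 1, by omega⟩
      simp only [Nat.add_sub_cancel]
      ring
    rw [this]
    simp [Nat.ModEq])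
  convert this using 1
  ext x
  have hx := hM ν hνM x
  simp only [Pi.mul_apply, Pi.pow_apply, Pi.inv_apply]
  obtain ⟨k, rfl⟩ : ∃ k, n = k + 1 := ⟨n - 1, by omega⟩
  simp only [Nat.add_sub_cancel]
  field_simp
  ring

end Recover

/-! ### Conjugation and the characteristic exponents -/

section Characteristic

variable {m n : ℕ} {b : Fin (m + 1) → ℕ} {α : ℂ⟦X⟧}

theorem dvd_mul_e_iff (n j : ℕ) (k : Fin (m + 1)) :
    n ∣ j * e b k ↔ ∀ r ≤ k, n ∣ j * b r := by
  have h : j * e b k = (Finset.Iic k).gcd fun r => j * b r := by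
    rw [Finset.gcd_mul_left, normalize_eq, e]
  simp [h, Finset.dvd_gcd_iff]

theorem HasCharacteristic.succ_le_succ (h : HasCharacteristic n α b) {r k : Fin m} (hrk : r ≤ k) :
    b r.succ ≤ b k.succ := by
  refine (h.succ r).2 ⟨(h.succ k).1.1, fun hdvd => (h.succ k).1.2 (dvd_trans ?_ hdvd)⟩
  exact Finset.gcd_mono (Finset.Iic_subset_Iic.2 (Fin.castSucc_le_castSucc_iff.2 hrk))

theorem HasCharacteristic.e_castSucc_dvd (h : HasCharacteristic n α b) {k : Fin m} {l : ℕ}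
    (hl : l ∈ supp α) (hlt : l < b k.succ) : e b k.castSucc ∣ l := by
  by_contra hdvd
  exact hlt.not_ge ((h.succ k).2 ⟨hl, hdvd⟩)

/-- An exponent in the support is divisible by some `e_k` with `b_k` at most this exponent. -/
theorem HasCharacteristic.exists_e_dvd (h : HasCharacteristic n α b) {l : ℕ} (hl : l ∈ supp α) :
    e b 0 ∣ l ∨ ∃ k : Fin m, e b k.succ ∣ l ∧ b k.succ ≤ l := by
  by_contra! hcon
  obtain ⟨h0, hsucc⟩ := hcon
  have hall : ∀ k : Fin (m + 1), ¬ e b k ∣ l := by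
    intro k
    induction k using Fin.induction with
    | zero => exact h0
    | succ k ih => exact fun hk => (hsucc k hk).not_ge ((h.succ k).2 ⟨hl, ih⟩)
  exact hall (Fin.last m) (h.last ▸ one_dvd l)

/-- The exponents of conjugation that fix the truncation below `i` of every parametrisation of the
given characteristic are the multiples of some `d`, and for smaller exponents the first change
is at a characteristic exponent. -/
theorem exists_conjugation_period {ι : Type*} {α : ι → ℂ⟦X⟧} [Nonempty ι] (hn : 0 < n)
    (h : ∀ x, HasCharacteristic n (α x) b) (i : ℕ) :
    ∃ d, 0 < d ∧ (∀ l < i, ∀ x, l ∈ supp (α x) → n ∣ d * l) ∧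
      ∀ j, 0 < j → j < d → ∃ k : Fin m, b k.succ < i ∧ ¬ n ∣ j * b k.succ ∧
        ∀ l < b k.succ, ∀ x, l ∈ supp (α x) → n ∣ j * l := by
  classical
  obtain ⟨x₀⟩ := ‹Nonempty ι›
  have hb0 : b 0 = n := (h x₀).zero
  -- The period is the least such `d`: fixing the characteristic terms below `i` already fixes every
  -- term below `i`.
  have hex : ∃ d, 0 < d ∧ ∀ k : Fin m, b k.succ < i → n ∣ d * b k.succ :=
    ⟨n, hn, fun _ _ => dvd_mul_right _ _⟩
  refine ⟨Nat.find hex, (Nat.find_spec hex).1, fun l hl x hlx => ?_, fun j hj0 hj => ?_⟩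
  · rcases (h x).exists_e_dvd hlx with h0 | ⟨k, hk, hkl⟩
    · have : n ∣ e b 0 := by
        rw [← one_mul (e b 0), dvd_mul_e_iff]
        intro r hr
        rw [Fin.le_zero_iff.1 hr, hb0, one_mul]
      exact ((this.trans h0).mul_left _)
    · refine dvd_trans ?_ (mul_dvd_mul_left _ hk)
      rw [dvd_mul_e_iff]
      intro r hr
      induction r using Fin.cases with
      | zero => rw [hb0]; exact dvd_mul_left _ _
      | succ r =>
        refine (Nat.find_spec hex).2 r ?_
        exact (((h x).succ_le_succ (Fin.succ_le_succ_iff.1 hr)).trans hkl).trans_lt hl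
  · have hmin := Nat.find_min hex hj
    push Not at hmin
    obtain ⟨k₀, hk₀, hnk₀⟩ := hmin hj0
    -- For the first characteristic exponent moved by `j`, all exponents before it are multiples of
    -- the preceding gcd, and `n` divides `j` times that gcd.
    obtain ⟨k, hk, hkmin⟩ := exists_minimal_of_wellFoundedLT
      (fun k : Fin m => ¬ n ∣ j * b k.succ) ⟨k₀, hnk₀⟩
    have hlt : ∀ r < k, n ∣ j * b r.succ := by
      intro r hr
      by_contra hdvd
      exact hr.not_ge (hkmin hdvd hr.le)
    have hkk₀ : k ≤ k₀ := by
      by_contra! hcon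
      exact hnk₀ (hlt k₀ hcon)
    refine ⟨k, ((h x₀).succ_le_succ hkk₀).trans_lt hk₀, hk, fun l hl x hlx => ?_⟩
    refine dvd_trans ?_ (mul_dvd_mul_left j ((h x).e_castSucc_dvd hlx hl))
    rw [dvd_mul_e_iff]
    intro r hr
    induction r using Fin.cases with
    | zero => rw [hb0]; exact dvd_mul_left _ _
    | succ r => exact hlt r (Fin.succ_le_castSucc_iff.1 hr)

/-- All coefficients of the parametrisations of a given characteristic are leading coefficients. -/
theorem isLeading_coeff {ι : Type*} {α : ι → ℂ⟦X⟧} [Nonempty ι] {B : Subalgebra ℂ (ι → ℂ)} {ζ : ℂ}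
    (hα : ∀ d q, (fun x => PowerSeries.coeff (n * q) (α x ^ d)) ∈ B) (hn : 0 < n)
    (hζ : IsPrimitiveRoot ζ n)
    {M : Submonoid (ι → ℂ)} (hM : ∀ φ ∈ M, ∀ x, φ x ≠ 0) (hMB : ∀ φ ∈ M, φ ∈ B → φ⁻¹ ∈ B)
    (hMC : ∀ c : ℂ, c ≠ 0 → (fun _ => c) ∈ M)
    (hMb : ∀ k : Fin m, (fun x => PowerSeries.coeff (b k.succ) (α x)) ∈ M)
    (h : ∀ x, HasCharacteristic n (α x) b) (i : ℕ) :
    IsLeading (branchAlgebra n B α) n i (fun x => PowerSeries.coeff i (α x)) := by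
  induction i using Nat.strong_induction_on with
  | _ i ih =>
    obtain ⟨d, hd, hdi, hr⟩ := exists_conjugation_period hn h i
    refine isLeading_coeff_of_lt hα hn hζ hM hMB hMC ih hd hdi fun j hj0 hj => ?_
    obtain ⟨k, hki, hnk, hlt⟩ := hr j hj0 hj
    exact ⟨b k.succ, hki, hnk, hMb k, hlt⟩

end Characteristic

/-! ### Coefficients of the Weierstrass polynomial -/

section WeierstrassCoefficients

theorem mem_of_sum_mem {R κ : Type*} [CommRing R] [DecidableEq κ] (B : Subring R) {s : Finset κ}
    {g : κ → R} {t : κ} (ht : t ∈ s) (hs : ∑ k ∈ s, g k ∈ B) (h : ∀ k ∈ s, k ≠ t → g k ∈ B) :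
    g t ∈ B := by
  rw [← Finset.add_sum_erase s g ht] at hs
  refine (add_mem_cancel_right (B.sum_mem fun k hk => ?_)).1 hs
  rw [Finset.mem_erase] at hk
  exact h k hk.2 hk.1

/-- If `f = w u`, where `w` is a Weierstrass polynomial of degree `n`, then the coefficients of
`w` are in every ring containing those of `f` and the inverse of the constant term of `u`. -/
theorem weierstrass_coeff_mem {R : Type*} [CommRing R] (B : Subring R) {n : ℕ} {f w u : ℕ → ℕ → R}
    (hfwu : ∀ i j, f i j = ∑ t ∈ Finset.HasAntidiagonal.antidiagonal i ×ˢ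
      Finset.HasAntidiagonal.antidiagonal j, w t.1.1 t.2.1 * u t.1.2 t.2.2)
    (hw0 : ∀ p, w 0 p = if p = n then 1 else 0) (hw : ∀ i, 0 < i → ∀ p, n ≤ p → w i p = 0)
    (hf : ∀ i j, f i j ∈ B) {v : R} (hv : v ∈ B) (hvu : v * u 0 0 = 1) (i p : ℕ) :
    w i p ∈ B := by
  classical
  -- Induction on the degree in X. In each degree, f_{i,p} with p < n gives w_{i,p} by an inner
  -- induction on p, and then f_{i,n+q} gives u_{i,q}, because w ≡ Yⁿ mod X.
  suffices h : ∀ i, (∀ p, w i p ∈ B) ∧ ∀ q, u i q ∈ B from (h i).1 p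
  intro i
  induction i using Nat.strong_induction_on with
  | _ i ih =>
    have hwi : ∀ p, w i p ∈ B := by
      rcases Nat.eq_zero_or_pos i with rfl | hi
      · intro p
        rw [hw0]
        split_ifs
        exacts [B.one_mem, B.zero_mem]
      · intro p
        induction p using Nat.strong_induction_on with
        | _ p ihp =>
          rcases le_or_gt n p with hp | hp
          · rw [hw i hi p hp]
            exact B.zero_mem
          · have hmem : w i p * u 0 0 ∈ B := by
              refine mem_of_sum_mem B (t := ((i, 0), (p, 0)))
                (g := fun t => w t.1.1 t.2.1 * u t.1.2 t.2.2) (by simp) (hfwu i p ▸ hf i p) ?_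
              rintro ⟨⟨a, b⟩, ⟨r, q⟩⟩ ht hne
              simp only [Finset.mem_product, Finset.HasAntidiagonal.mem_antidiagonal] at ht
              obtain ⟨hab, hrq⟩ := ht
              rcases Nat.eq_zero_or_pos a with rfl | ha
              · simp only [hw0]
                rw [if_neg (by omega), zero_mul]
                exact B.zero_mem
              · refine B.mul_mem ?_ ((ih b (by omega)).2 q)
                rcases Nat.lt_or_ge a i with hai | hai
                · exact (ih a hai).1 r
                · obtain rfl : a = i := by omega
                  obtain rfl : b = 0 := by omega
                  refine ihp r (lt_of_le_of_ne (by omega) ?_)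
                  rintro rfl
                  obtain rfl : q = 0 := by omega
                  exact hne rfl
            have : w i p = v * (w i p * u 0 0) := by
              rw [mul_left_comm, hvu, mul_one]
            rw [this]
            exact B.mul_mem hv hmem
    refine ⟨hwi, fun q => ?_⟩
    have hmem : w 0 n * u i q ∈ B := by
      refine mem_of_sum_mem B (t := ((0, i), (n, q)))
        (g := fun t => w t.1.1 t.2.1 * u t.1.2 t.2.2) (by simp) (hfwu i (n + q) ▸ hf i (n + q)) ?_
      rintro ⟨⟨a, b⟩, ⟨r, s⟩⟩ ht hne
      simp only [Finset.mem_product, Finset.HasAntidiagonal.mem_antidiagonal] at ht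
      obtain ⟨hab, hrs⟩ := ht
      rcases Nat.eq_zero_or_pos a with rfl | ha
      · obtain rfl : b = i := by omega
        simp only [hw0]
        rw [if_neg, zero_mul]
        · exact B.zero_mem
        · rintro rfl
          obtain rfl : s = q := by omega
          exact hne rfl
      · refine B.mul_mem ?_ ((ih b (by omega)).2 s)
        rcases Nat.lt_or_ge a i with hai | hai
        · exact (ih a hai).1 r
        · obtain rfl : a = i := by omega
          exact hwi r
    simpa [hw0] using hmem

variable {f : ℂ⟦X⟧⟦X⟧} {w : Polynomial ℂ⟦X⟧} {u : ℂ⟦X⟧⟦X⟧}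

theorem seriesCoeff_eq_sum (h : f.IsWeierstrassFactorization w u) (i j : ℕ) :
    seriesCoeff f i j = ∑ t ∈ Finset.HasAntidiagonal.antidiagonal i ×ˢ
      Finset.HasAntidiagonal.antidiagonal j,
        seriesCoeff w t.1.1 t.2.1 * seriesCoeff u t.1.2 t.2.2 := by
  rw [Finset.sum_product_right, h.eq_mul]
  simp only [seriesCoeff, PowerSeries.coeff_mul, map_sum]

theorem seriesCoeff_weierstrass_zero (h : f.IsWeierstrassFactorization w u) (p : ℕ) :
    seriesCoeff w 0 p = if p = w.natDegree then 1 else 0 := by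
  rw [seriesCoeff, Polynomial.coeff_coe, PowerSeries.coeff_zero_eq_constantCoeff]
  rcases lt_trichotomy p w.natDegree with hp | rfl | hp
  · rw [if_neg hp.ne]
    have := h.isDistinguishedAt.mem hp
    rw [IsLocalRing.mem_maximalIdeal, mem_nonunits_iff, PowerSeries.isUnit_iff_constantCoeff,
      isUnit_iff_ne_zero, not_not] at this
    exact this
  · simp [h.isDistinguishedAt.monic]
  · simp [Polynomial.coeff_eq_zero_of_natDegree_lt hp, hp.ne']

theorem seriesCoeff_weierstrass_eq_zero (h : f.IsWeierstrassFactorization w u) {i : ℕ} (hi : 0 < i)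
    {p : ℕ} (hp : w.natDegree ≤ p) : seriesCoeff w i p = 0 := by
  rw [seriesCoeff, Polynomial.coeff_coe]
  rcases hp.eq_or_lt with rfl | hp
  · simp [h.isDistinguishedAt.monic, PowerSeries.coeff_one, hi.ne']
  · simp [Polynomial.coeff_eq_zero_of_natDegree_lt hp]

theorem seriesCoeff_zero_natDegree (h : f.IsWeierstrassFactorization w u) :
    seriesCoeff f 0 w.natDegree = seriesCoeff u 0 0 := by
  rw [seriesCoeff_eq_sum h, Finset.sum_eq_single ((0, 0), (w.natDegree, 0))]
  · simp [seriesCoeff_weierstrass_zero h]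
  · rintro ⟨⟨a, b⟩, ⟨r, q⟩⟩ ht hne
    simp only [Finset.mem_product, Finset.HasAntidiagonal.mem_antidiagonal] at ht
    obtain ⟨hab, hrq⟩ := ht
    obtain rfl : a = 0 := by omega
    obtain rfl : b = 0 := by omega
    simp only [seriesCoeff_weierstrass_zero h]
    rw [if_neg, zero_mul]
    rintro rfl
    obtain rfl : q = 0 := by omega
    exact hne rfl
  · simp

theorem seriesCoeff_zero_natDegree_ne_zero (h : f.IsWeierstrassFactorization w u) :
    seriesCoeff f 0 w.natDegree ≠ 0 := by
  rw [seriesCoeff_zero_natDegree h, seriesCoeff, PowerSeries.coeff_zero_eq_constantCoeff,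
    PowerSeries.coeff_zero_eq_constantCoeff, ← isUnit_iff_ne_zero]
  exact (h.isUnit.map _).map _

theorem weierstrass_seriesCoeff_mem {ι : Type*} {B : Subalgebra ℂ (ι → ℂ)} {n : ℕ}
    {f u : ι → ℂ⟦X⟧⟦X⟧} {w : ι → Polynomial ℂ⟦X⟧}
    (h : ∀ x, (f x).IsWeierstrassFactorization (w x) (u x)) (hn : ∀ x, (w x).natDegree = n)
    (hf : ∀ i j, (fun x => seriesCoeff (f x) i j) ∈ B)
    (hinv : (fun x => seriesCoeff (f x) 0 n)⁻¹ ∈ B) (i j : ℕ) :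
    (fun x => seriesCoeff (w x) i j) ∈ B := by
  refine weierstrass_coeff_mem B.toSubring (n := n)
    (f := fun i j x => seriesCoeff (f x) i j) (w := fun i j x => seriesCoeff (w x) i j)
    (u := fun i j x => seriesCoeff (u x) i j) (fun i j => ?_) (fun p => ?_)
    (fun i hi p hp => ?_) hf hinv ?_ i j
  · ext x
    simp [seriesCoeff_eq_sum (h x)]
  · ext x
    rw [seriesCoeff_weierstrass_zero (h x), hn]
    split_ifs <;> rfl
  · ext x
    exact seriesCoeff_weierstrass_eq_zero (h x) hi (hn x ▸ hp)
  · ext x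
    have := seriesCoeff_zero_natDegree_ne_zero (h x)
    rw [hn] at this
    rw [Pi.mul_apply, Pi.inv_apply, ← seriesCoeff_zero_natDegree (h x), hn]
    exact inv_mul_cancel₀ this

end WeierstrassCoefficients

/-! ### Conjugate parametrisations as roots -/

section Conjugates

theorem eq_prod_X_sub_C_of_injective {R : Type*} [CommRing R] [IsDomain R] {p : Polynomial R}
    {n : ℕ} (hp : p.Monic) (hn : p.natDegree = n) {β : Fin n → R} (hβ : Function.Injective β)
    (hroot : ∀ j, p.IsRoot (β j)) : p = ∏ j, (Polynomial.X - Polynomial.C (β j)) := by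
  refine Polynomial.eq_of_monic_of_dvd_of_natDegree_le
    (Polynomial.monic_prod_of_monic _ _ fun j _ => Polynomial.monic_X_sub_C _) hp ?_ ?_
  · have hle : Finset.univ.val.map β ≤ p.roots := by
      rw [Multiset.le_iff_subset (Finset.univ.nodup.map hβ)]
      intro a ha
      obtain ⟨j, -, rfl⟩ := Multiset.mem_map.1 ha
      exact (Polynomial.mem_roots hp.ne_zero).2 (hroot j)
    have := (Multiset.prod_X_sub_C_dvd_iff_le_roots hp.ne_zero _).2 hle
    rwa [Multiset.map_map] at this
  · rw [Polynomial.natDegree_prod_of_monic _ _ fun j _ => Polynomial.monic_X_sub_C _]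
    simp [hn]

variable {w : Polynomial ℂ⟦X⟧} {α α' : ℂ⟦X⟧} {n : ℕ} {ζ : ℂ}

theorem IsPuiseuxParametrisation.rescale_injective (h : IsPuiseuxParametrisation n α)
    (hζ : IsPrimitiveRoot ζ n) :
    Function.Injective fun j : Fin n => PowerSeries.rescale (ζ ^ (j : ℕ)) α := by
  have hlt : ∀ i j : Fin n, i < j →
      PowerSeries.rescale (ζ ^ (i : ℕ)) α ≠ PowerSeries.rescale (ζ ^ (j : ℕ)) α := by
    intro i j hij heq
    set d := (j : ℕ) - i with hd
    have hd0 : 0 < d := Nat.sub_pos_of_lt hij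
    have hdn : d < n := by omega
    have hζ0 : ζ ≠ 0 := hζ.ne_zero h.pos.ne'
    have hdvd : ∀ l ∈ insert n (supp α), n ∣ d * l := by
      rintro l (rfl | hl)
      · exact dvd_mul_left _ _
      · have h1 := congrArg (PowerSeries.coeff l) heq
        rw [PowerSeries.coeff_rescale, PowerSeries.coeff_rescale] at h1
        have h2 := mul_right_cancel₀ hl h1
        rw [← hζ.pow_eq_one_iff_dvd, pow_mul]
        have h3 : (ζ ^ (j : ℕ)) = ζ ^ d * ζ ^ (i : ℕ) := by
          rw [← pow_add]
          congr 1
          omega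
        rw [h3, mul_pow] at h2
        exact (mul_eq_right₀ (pow_ne_zero _ (pow_ne_zero _ hζ0))).1 h2.symm
    -- The number g = n / gcd(n, d) divides `n` and the whole support, so it is 1; then `n ∣ d`,
    -- against 0 < d < n.
    obtain ⟨g, hg⟩ := Nat.gcd_dvd_left n d
    have hgcd : 0 < Nat.gcd n d := Nat.gcd_pos_of_pos_left _ h.pos
    have hg1 : g ∣ 1 := by
      rw [← h.setGcd_eq_one, Nat.dvd_setGcd_iff]
      intro l hl
      have hco : Nat.Coprime g (d / Nat.gcd n d) := by
        have := Nat.coprime_div_gcd_div_gcd hgcd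
        rwa [Nat.div_eq_of_eq_mul_right hgcd hg] at this
      refine hco.dvd_of_dvd_mul_left ?_
      refine Nat.dvd_of_mul_dvd_mul_left hgcd ?_
      rw [← mul_assoc, Nat.mul_div_cancel' (Nat.gcd_dvd_right n d), ← hg]
      exact hdvd l hl
    rw [Nat.dvd_one.1 hg1, mul_one] at hg
    exact absurd (Nat.le_of_dvd hd0 (Nat.gcd_eq_left_iff_dvd.1 hg.symm)) (by omega)
  intro i j hij
  rcases lt_trichotomy i j with h1 | h1 | h1
  exacts [absurd hij (hlt i j h1), h1, absurd hij.symm (hlt j i h1)]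

theorem rescale_expand (hn : n ≠ 0) {ε : ℂ} (hε : ε ^ n = 1) (φ : ℂ⟦X⟧) :
    PowerSeries.rescale ε (PowerSeries.expand n hn φ) = PowerSeries.expand n hn φ := by
  ext l
  rw [PowerSeries.coeff_rescale]
  by_cases hl : n ∣ l
  · obtain ⟨q, rfl⟩ := hl
    rw [pow_mul, hε, one_pow, one_mul]
  · rw [PowerSeries.coeff_expand_of_not_dvd _ _ _ hl, mul_zero]

/-- Rotations by n-th roots of unity fix series in Tⁿ, so they carry the root α to roots; the n
rotations are distinct and exhaust the degree. -/
theorem map_expand_eq_prod (hw : w.Monic) (hwn : w.natDegree = n)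
    (h : IsPuiseuxParametrisationOfPolynomial w α) (hζ : IsPrimitiveRoot ζ n) (hn : n ≠ 0) :
    w.map (PowerSeries.expand n hn : ℂ⟦X⟧ →ₐ[ℂ] ℂ⟦X⟧).toRingHom =
      ∏ j : Fin n, (Polynomial.X - Polynomial.C (PowerSeries.rescale (ζ ^ (j : ℕ)) α)) := by
  subst hwn
  obtain ⟨hp, h0⟩ := h
  set E := (PowerSeries.expand w.natDegree hn : ℂ⟦X⟧ →ₐ[ℂ] ℂ⟦X⟧).toRingHom with hE
  have hmonic : (w.map E).Monic := hw.map E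
  have hroot : ∀ j : ℕ, (w.map E).IsRoot (PowerSeries.rescale (ζ ^ j) α) := by
    intro j
    have h1 := congrArg (PowerSeries.rescale (ζ ^ j)) h0
    rw [Polynomial.hom_eval₂, map_zero] at h1
    rw [Polynomial.IsRoot, Polynomial.eval_map, ← h1]
    congr 1
    ext1 φ
    refine (rescale_expand hn ?_ φ).symm
    rw [← pow_mul, mul_comm, pow_mul, hζ.pow_eq_one, one_pow]
  exact eq_prod_X_sub_C_of_injective hmonic (hw.natDegree_map E) (hp.rescale_injective hζ)
    fun j => hroot j

theorem supp_rescale {ε : ℂ} (hε : ε ≠ 0) (α : ℂ⟦X⟧) : supp (PowerSeries.rescale ε α) = supp α := by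
  ext l
  simp [supp, PowerSeries.coeff_rescale, hε]

/-- The parametrisations of an irreducible Weierstrass polynomial are conjugate. -/
theorem supp_eq_supp (hw : w.Monic) (h : IsPuiseuxParametrisationOfPolynomial w α)
    (h' : IsPuiseuxParametrisationOfPolynomial w α') : supp α' = supp α := by
  obtain ⟨hp', h0'⟩ := id h'
  have hζ := Complex.isPrimitiveRoot_exp w.natDegree hp'.pos.ne'
  rw [← Polynomial.eval_map, map_expand_eq_prod hw rfl h hζ hp'.pos.ne', Polynomial.eval_prod,
    Finset.prod_eq_zero_iff] at h0'
  obtain ⟨j, -, hj⟩ := h0'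
  rw [Polynomial.eval_sub, Polynomial.eval_X, Polynomial.eval_C, sub_eq_zero] at hj
  rw [hj, supp_rescale (pow_ne_zero _ (hζ.ne_zero hp'.pos.ne'))]

theorem HasCharacteristic.congr_supp {m : ℕ} {b : Fin (m + 1) → ℕ} (h : HasCharacteristic n α b)
    (hs : supp α' = supp α) : HasCharacteristic n α' b :=
  ⟨h.zero, fun k => hs ▸ h.succ k, h.last⟩

/-- Rotation does not change coefficients at multiples of `n`, so those of `α ^ d` are 1/n times
those of the d-th power sum of the conjugates. -/
theorem coeff_pow_mem {ι : Type*} {B : Subalgebra ℂ (ι → ℂ)} {w : ι → Polynomial ℂ⟦X⟧}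
    {α : ι → ℂ⟦X⟧} (hw : ∀ x, (w x).Monic) (hwn : ∀ x, (w x).natDegree = n)
    (h : ∀ x, IsPuiseuxParametrisationOfPolynomial (w x) (α x)) (hζ : IsPrimitiveRoot ζ n)
    (hn : n ≠ 0) (hB : ∀ i j, (fun x => seriesCoeff (w x) i j) ∈ B) (d q : ℕ) :
    (fun x => PowerSeries.coeff (n * q) (α x ^ d)) ∈ B := by
  set β : Fin n → ι → ℂ⟦X⟧ := fun j => rotate ι (ζ ^ (j : ℕ)) α with hβ
  have hcoeff : ∀ k, (∏ j, (Polynomial.X - Polynomial.C (β j))).coeff k ∈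
      (periodicFamilies n B).toSubring := by
    intro k
    have : (∏ j, (Polynomial.X - Polynomial.C (β j))).coeff k =
        fun x => PowerSeries.expand n hn ((w x).coeff k) := by
      ext1 x
      have hx := map_expand_eq_prod (hw x) (hwn x) (h x) hζ hn
      have hprod : (∏ j, (Polynomial.X - Polynomial.C (β j))).map
          (Pi.evalRingHom (fun _ => ℂ⟦X⟧) x) =
          (w x).map (PowerSeries.expand n hn : ℂ⟦X⟧ →ₐ[ℂ] ℂ⟦X⟧).toRingHom := by
        rw [hx, Polynomial.map_prod]
        simp [hβ, rotate_apply]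
      have := congrArg (fun p => Polynomial.coeff p k) hprod
      simp only [Polynomial.coeff_map] at this
      exact this
    rw [this]
    intro l
    refine ⟨?_, fun hl x => PowerSeries.coeff_expand_of_not_dvd _ _ _ hl⟩
    simp only [PowerSeries.coeff_expand]
    split_ifs
    · convert hB (l / n) k using 1
      ext x
      rw [seriesCoeff, Polynomial.coeff_coe]
    · exact B.zero_mem
  have hsum := (sum_pow_mem_of_coeff_prod_X_sub_C_mem _ β hcoeff d (n * q)).1
  convert B.smul_mem hsum (n : ℂ)⁻¹ using 1
  ext x
  have hterm : ∀ j : Fin n, PowerSeries.coeff (n * q) (β j x ^ d) =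
      PowerSeries.coeff (n * q) (α x ^ d) := by
    intro j
    rw [show β j x = PowerSeries.rescale (ζ ^ (j : ℕ)) (α x) from rfl, ← map_pow, PowerSeries.coeff_rescale, ← pow_mul,
      (hζ.pow_eq_one_iff_dvd _).2 ((dvd_mul_right n q).mul_left _), one_mul]
  have hn' : (n : ℂ) ≠ 0 := Nat.cast_ne_zero.2 hn
  simp [Finset.sum_apply, hterm, hn']

end Conjugates

/-! ### Invariant polynomials -/

section Invariant

/-- A primitive root ζ multiplies each monomial by ζ to the power of its weight; comparing
coefficients forces this factor to be 1. -/
theorem IsRootsOfUnityInvariant.dvd_sum {I : Set ℕ} {n : ℕ} {Q : MvPolynomial I ℂ}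
    (hQ : IsRootsOfUnityInvariant n Q) (hn : n ≠ 0) {s : I →₀ ℕ} (hs : s ∈ Q.support) :
    n ∣ ∑ i ∈ s.support, s i * (i : ℕ) := by
  have hζ := Complex.isPrimitiveRoot_exp n hn
  set ζ := Complex.exp (2 * Real.pi * Complex.I / n)
  have hmon : ∀ t : I →₀ ℕ, ∀ c : ℂ,
      MvPolynomial.bind₁ (fun i : I => MvPolynomial.C (ζ ^ (i : ℕ)) * MvPolynomial.X i)
        (MvPolynomial.monomial t c) =
      MvPolynomial.monomial t (ζ ^ (∑ i ∈ t.support, t i * (i : ℕ)) * c) := by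
    intro t c
    rw [MvPolynomial.bind₁_monomial, MvPolynomial.monomial_eq, Finsupp.prod,
      ← Finset.prod_pow_eq_pow_sum]
    simp only [mul_pow, Finset.prod_mul_distrib, ← map_pow, ← map_prod, map_mul]
    simp only [← pow_mul, mul_comm (_ : ℕ) (t _)]
    ring
  have hcoeff := congrArg (MvPolynomial.coeff s) (hQ ζ hζ.pow_eq_one)
  conv_lhs at hcoeff => rw [Q.as_sum, map_sum, MvPolynomial.coeff_sum]
  simp only [hmon, MvPolynomial.coeff_monomial] at hcoeff
  rw [Finset.sum_ite_eq_of_mem' _ _ _ hs] at hcoeff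
  rw [← hζ.pow_eq_one_iff_dvd]
  exact (mul_eq_right₀ (MvPolynomial.mem_support_iff.1 hs)).1 hcoeff

theorem evalParam_mem {ι : Type*} {A : Subalgebra ℂ (ι → ℂ⟦X⟧)} {B : Subalgebra ℂ (ι → ℂ)}
    {α : ι → ℂ⟦X⟧} {n : ℕ} (hn : n ≠ 0)
    (hA : ∀ d φ, IsLeading A n d φ → n ∣ d → φ ∈ B)
    (hα : ∀ i, IsLeading A n i fun x => PowerSeries.coeff i (α x))
    {I : Set ℕ} {Q : MvPolynomial I ℂ} (hQ : IsRootsOfUnityInvariant n Q) :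
    (fun x => evalParam (α x) Q) ∈ B := by
  have : (fun x => evalParam (α x) Q) = ∑ s ∈ Q.support, MvPolynomial.coeff s Q •
      ∏ i ∈ s.support, (fun x => PowerSeries.coeff (i : ℕ) (α x)) ^ s i := by
    ext x
    simp [evalParam, MvPolynomial.eval_eq]
  rw [this]
  refine B.sum_mem fun s hs => B.smul_mem (hA _ _ ?_ (hQ.dvd_sum hn hs)) _
  exact IsLeading.prod _ _ _ fun i _ => (hα i).pow (s i)

end Invariant

/-! ### The monomial denominators -/

section Monomials

variable {ι : Type*} {m : ℕ}

/-- Functions of the form `a c^N ∏ A_k^{l_k}` with `a ≠ 0`. -/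
def monomialSubmonoid (c : ι → ℂ) (A : Fin m → ι → ℂ) : Submonoid (ι → ℂ) where
  carrier := {φ | ∃ (a : ℂ) (N : ℕ) (l : Fin m → ℕ), a ≠ 0 ∧
    ∀ x, φ x = a * (c x ^ N * ∏ k, A k x ^ l k)}
  mul_mem' := by
    rintro φ ψ ⟨a, N, l, ha, h⟩ ⟨a', N', l', ha', h'⟩
    refine ⟨a * a', N + N', l + l', mul_ne_zero ha ha', fun x => ?_⟩
    simp only [Pi.mul_apply, h, h', Pi.add_apply, pow_add, Finset.prod_mul_distrib]
    ring
  one_mem' := ⟨1, 0, 0, one_ne_zero, by simp⟩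

variable {c : ι → ℂ} {A : Fin m → ι → ℂ}

theorem const_mem_monomialSubmonoid {a : ℂ} (ha : a ≠ 0) :
    (fun _ => a) ∈ monomialSubmonoid c A :=
  ⟨a, 0, 0, ha, by simp⟩

theorem base_mem_monomialSubmonoid : c ∈ monomialSubmonoid c A :=
  ⟨1, 1, 0, one_ne_zero, by simp⟩

theorem factor_mem_monomialSubmonoid (k : Fin m) : A k ∈ monomialSubmonoid c A := by
  classical
  refine ⟨1, 0, Pi.single k 1, one_ne_zero, fun x => ?_⟩
  rw [Finset.prod_eq_single k]
  · simp
  · intro j _ hj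
    simp [Pi.single_eq_of_ne hj]
  · simp

theorem ne_zero_of_mem_monomialSubmonoid (hc : ∀ x, c x ≠ 0) (hA : ∀ k x, A k x ≠ 0) {φ : ι → ℂ}
    (hφ : φ ∈ monomialSubmonoid c A) (x : ι) : φ x ≠ 0 := by
  obtain ⟨a, N, l, ha, h⟩ := hφ
  rw [h]
  exact mul_ne_zero ha (mul_ne_zero (pow_ne_zero _ (hc x))
    (Finset.prod_ne_zero_iff.2 fun k _ => pow_ne_zero _ (hA k x)))

end Monomials

end PlaneBranch

/-! ### The theorem -/

theorem corollary5p2 (m : ℕ) (b : Fin (m + 1) → ℕ)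
    (Q : MvPolynomial (PlaneBranch.indexSet b) ℂ)
    (hQ : PlaneBranch.IsRootsOfUnityInvariant (b 0) Q) :
    ∃ (W V : MvPolynomial (ℕ × ℕ) ℂ) (N : ℕ) (l : Fin m → ℕ),
      ∀ (f : PowerSeries (PowerSeries ℂ)) (α : PowerSeries ℂ),
        PlaneBranch.IsInSeriesClass b f →
        PlaneBranch.IsPuiseuxParametrisationOf f α →
          PlaneBranch.evalSeries f V =
              PlaneBranch.seriesCoeff f 0 (b 0) ^ N *
                ∏ k : Fin m, PowerSeries.coeff (b k.succ) α ^ l k ∧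
            PlaneBranch.evalSeries f V ≠ 0 ∧
            PlaneBranch.evalParam α Q =
              PlaneBranch.evalSeries f W / PlaneBranch.evalSeries f V := by
  open PlaneBranch in
  let ι := {p : ℂ⟦X⟧⟦X⟧ × ℂ⟦X⟧ // IsInSeriesClass b p.1 ∧ IsPuiseuxParametrisationOf p.1 p.2}
  rcases isEmpty_or_nonempty ι with hι | hι
  · exact ⟨0, 0, 0, 0, fun f α hf hα => (hι.false ⟨(f, α), hf, hα⟩).elim⟩
  have hdata : ∀ x : ι, ∃ (w : Polynomial ℂ⟦X⟧) (u : ℂ⟦X⟧⟦X⟧),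
      x.1.1.IsWeierstrassFactorization w u ∧ w.natDegree = b 0 ∧
      IsPuiseuxParametrisationOfPolynomial w x.1.2 ∧ HasCharacteristic (b 0) x.1.2 b := by
    rintro ⟨⟨f, α⟩, hf, w, u, hwu, hα⟩
    obtain ⟨w', u', hwu', hw'⟩ := hf.exists_weierstrass
    -- Uniqueness of the Weierstrass factorisation identifies the polynomial of the class with the
    -- one that α parametrises.
    obtain ⟨rfl, rfl⟩ := hwu.elim hwu'
    obtain ⟨α', hα', hchar⟩ := hw'.hasCharacteristic
    refine ⟨w, u, hwu, hw'.natDegree_eq, hα, hw'.natDegree_eq ▸ hchar.congr_supp ?_⟩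
    exact supp_eq_supp hwu.isDistinguishedAt.monic hα' hα
  choose w u hwu hdeg hpar hchar using hdata
  have hn : 0 < b 0 := by
    obtain ⟨x⟩ := hι
    rw [← hdeg x]
    exact (hpar x).1.pos
  have hζ := Complex.isPrimitiveRoot_exp (b 0) hn.ne'
  let α : ι → ℂ⟦X⟧ := fun x => x.1.2
  let c : ℕ × ℕ → ι → ℂ := fun p x => seriesCoeff x.1.1 p.1 p.2
  let A : Fin m → ι → ℂ := fun k x => PowerSeries.coeff (b k.succ) x.1.2
  let P : Subalgebra ℂ (ι → ℂ) := (MvPolynomial.aeval c).range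
  let M : Submonoid (ι → ℂ) := monomialSubmonoid (c (0, b 0)) A
  let B := localizedSubalgebra P M
  have hM : ∀ φ ∈ M, ∀ x, φ x ≠ 0 := fun φ hφ x =>
    ne_zero_of_mem_monomialSubmonoid
      (fun x => hdeg x ▸ seriesCoeff_zero_natDegree_ne_zero (hwu x))
      (fun k x => ((hchar x).succ k).1.1) hφ x
  have hMB : ∀ φ ∈ M, φ ∈ B → φ⁻¹ ∈ B := fun φ hφM hφ =>
    mem_localizedSubalgebra_of_mul_eq_one hφM hφ (funext fun x => mul_inv_cancel₀ (hM φ hφM x))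
  have hP : ∀ p, c p ∈ P := fun p => ⟨MvPolynomial.X p, MvPolynomial.aeval_X c p⟩
  have hPB : P ≤ B := le_localizedSubalgebra P M
  have hwB := weierstrass_seriesCoeff_mem hwu hdeg (fun i j => hPB (hP (i, j)))
    (hMB _ base_mem_monomialSubmonoid (hPB (hP (0, b 0))))
  have hα : ∀ d q, (fun x => PowerSeries.coeff (b 0 * q) (α x ^ d)) ∈ B :=
    coeff_pow_mem (fun x => (hwu x).isDistinguishedAt.monic) hdeg hpar hζ hn.ne' hwB
  have hlead := isLeading_coeff hα hn hζ hM hMB (fun _ => const_mem_monomialSubmonoid)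
    factor_mem_monomialSubmonoid hchar
  obtain ⟨μ, ⟨a, N, l, ha, hμ⟩, ⟨V, hV⟩, ⟨W, hW⟩⟩ :=
    evalParam_mem hn.ne' (fun d φ => mem_of_isLeading hα) hlead hQ
  have heval : ∀ (R : MvPolynomial (ℕ × ℕ) ℂ) (x : ι),
      MvPolynomial.aeval c R x = evalSeries x.1.1 R := by
    intro R x
    have := MvPolynomial.comp_aeval_apply c (Pi.evalAlgHom ℂ (fun _ : ι => ℂ) x) R
    have h : MvPolynomial.aeval c R x = MvPolynomial.eval (fun p => c p x) R := by
      simpa [MvPolynomial.aeval_eq_eval] using this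
    exact h
  -- The denominator found is a monomial only up to the constant `a`, which collects factors such as
  -- 1 − ζ^(j b_k); it is divided out of `W` and `V`.
  refine ⟨MvPolynomial.C a⁻¹ * W, MvPolynomial.C a⁻¹ * V, N, l, fun f β hf hβ => ?_⟩
  let x : ι := ⟨(f, β), hf, hβ⟩
  have hVx : evalSeries f V = μ x := by
    rw [← hV]
    exact (heval V x).symm
  have hWx : evalSeries f W = μ x * evalParam β Q := by
    have := congrFun hW x
    exact (heval W x).symm.trans this
  have hμM : μ ∈ M := ⟨a, N, l, ha, hμ⟩
  have hμx : μ x ≠ 0 := hM μ hμM x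
  have hC : ∀ R, evalSeries f (MvPolynomial.C a⁻¹ * R) = a⁻¹ * evalSeries f R := by
    simp [evalSeries]
  refine ⟨?_, ?_, ?_⟩
  · rw [hC, hVx, hμ, inv_mul_cancel_left₀ ha]
  · rw [hC, hVx]
    exact mul_ne_zero (inv_ne_zero ha) hμx
  · rw [hC, hC, hVx, hWx]
    field_simp
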